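/- For a group $G$ with a free presentation $G\cong F/R$ (where $F$ is a free group and $R$ a normal subgroup of $F$), the Schur multiplier of $G$ is the group $$M(G)=(R\cap F')/[R,F],$$ where $F'=[F,F]$; up to isomorphism it does not depend on the presentation. Let a group $G$ be the free product of its two subgroups $G_1$ and $G_2$ with amalgamated subgroup $H$; that is, $H\le G_1$, $H\le G_2$, and the homomorphism $G_1*_HG_2\to G$ induced by the inclusions is an isomorphism. Then, for any choice of free presentations of $G$, $G_1$, $G_2$ and $H$ to compute the Schur multipliers, the following hold. (i) If $M(H)$ is trivial, then $M(G)$ contains a subgroup isomorphic to $M(G_1)\oplus M(G_2)$. (ii) If $H$ is a perfect group and $M(H)$ is trivial, then $M(G)\cong M(G_1)\oplus M(G_2)$. -/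

import Mathlib

/-- A free presentation of the group `G`: a surjective homomorphism onto `G` from a free group `F`.
With `R` its kernel, `F / R` is isomorphic to `G`. -/
structure FreePresentation (F G : Type*) [Group F] [IsFreeGroup F] [Group G] where
  /-- the projection of the free group onto `G` -/
  hom : F →* G
  surjective : Function.Surjective hom

namespace FreePresentation

/-- The group `R` of relations of a free presentation. -/
def relations {F G : Type*} [Group F] [IsFreeGroup F] [Group G]
    (P : FreePresentation F G) : Subgroup F :=
  P.hom.ker

instance {F G : Type*} [Group F] [IsFreeGroup F] [Group G]
    (P : FreePresentation F G) : P.relations.Normal :=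
  inferInstanceAs P.hom.ker.Normal

/-- The Schur multiplier `(R ∩ F') / [R, F]` of `G`, computed from the free presentation `F / R`.
Here `[R, F] ≤ R ∩ F'` since `R` is normal, so that `subgroupOf` loses nothing. -/
abbrev SchurMultiplier {F G : Type*} [Group F] [IsFreeGroup F] [Group G]
    (P : FreePresentation F G) : Type _ :=
  ↥(P.relations ⊓ commutator F) ⧸
    (⁅P.relations, (⊤ : Subgroup F)⁆.subgroupOf (P.relations ⊓ commutator F))

end FreePresentation

/-- `G` is the free product of its subgroups `G₁` and `G₂` with amalgamated subgroup `H`: the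
subgroup `H` lies in `G₁` and in `G₂`, and the homomorphism from the pushout of `G₁ ← H → G₂`
to `G` that the inclusions induce is an isomorphism. -/
def IsAmalgamatedProduct {G : Type*} [Group G] (G₁ G₂ H : Subgroup G) : Prop :=
  ∃ h : ∀ i : Fin 2, H ≤ ![G₁, G₂] i,
    Function.Bijective
      (Monoid.PushoutI.lift (φ := fun i => Subgroup.inclusion (h i))
        (fun i => (![G₁, G₂] i).subtype) H.subtype (fun _ => rfl))

/-! Everything is dual to `ℚ/ℤ`. Since `ℚ/ℤ` is injective, the characters of `M(G)` are exactly
those induced by central extensions of `G` by `ℚ/ℤ` (`exists_centralExtension`,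
`FreePresentation.exists_character`), and a homomorphism into `G` lifts to such an extension once
the pulled-back character vanishes (`IsCentral.exists_lift`). Inclusions induce a map `M(G₁) × M(G₂)
→ M(G)`. It is injective if every pair of characters of the factors comes from a character of
`M(G)`. When `M(H)` is trivial, the corresponding extensions of `G₁` and `G₂` both split over `H`,
so they contain `ℚ/ℤ × H` and can be amalgamated along it (`exists_amalgam`); the result is a
central extension of `G` restricting to both. It is surjective if a character vanishing on both
images is trivial. The extension of such a character splits over `G₁` and over `G₂`. If `H` is
perfect, the two splittings agree on `H` and glue to a splitting over `G`. -/

open Monoid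

/-! ### Characters with values in `ℚ/ℤ` -/

/-- The group `ℚ/ℤ`, written multiplicatively. -/
abbrev RatCircle : Type := Multiplicative (AddCircle (1 : ℚ))

/-- The group `ℚ/ℤ` is injective: a homomorphism into it extends along any homomorphism of its
source to a commutative group whose kernel it kills. -/
theorem RatCircle.exists_extension {A B : Type*} [Group A] [CommGroup B] (f : A →* B)
    (g : A →* RatCircle) (h : f.ker ≤ g.ker) : ∃ k : B →* RatCircle, k.comp f = g := by
  let g' : f.range →* RatCircle :=
    f.rangeRestrict.liftOfSurjective f.rangeRestrict_surjective ⟨g, by rwa [f.ker_rangeRestrict]⟩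
  have hg' : ∀ x, g' (f.rangeRestrict x) = g x :=
    MonoidHom.liftOfRightInverse_comp_apply _ _ _ _
  obtain ⟨k, hk⟩ := (Module.Baer.of_divisible (AddCircle (1 : ℚ))).extension_property_addMonoidHom
    f.range.subtype.toAdditive (fun x y hxy => Subtype.ext hxy) (MonoidHom.toAdditiveLeft g')
  refine ⟨MonoidHom.toAdditiveLeft.symm k, MonoidHom.ext fun x => ?_⟩
  rw [← hg']
  exact congrArg Multiplicative.ofAdd (DFunLike.congr_fun hk (Additive.ofMul (f.rangeRestrict x)))

theorem RatCircle.eq_one_of_forall {A : Type*} [CommGroup A] {a : A}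
    (h : ∀ c : A →* RatCircle, c a = 1) : a = 1 := by
  have : Additive.ofMul a = 0 :=
    CharacterModule.eq_zero_of_character_apply fun c => h (MonoidHom.toAdditiveLeft.symm c)
  exact this

/-- A homomorphism from a subgroup to `ℚ/ℤ` that is trivial on commutators of the whole group
extends to the whole group. -/
theorem RatCircle.exists_extension_of_commutator {G : Type*} [Group G] (R : Subgroup G)
    (g : R →* RatCircle) (h : ∀ r : R, (r : G) ∈ commutator G → g r = 1) :
    ∃ k : G →* RatCircle, ∀ r : R, k r = g r := by
  obtain ⟨k, hk⟩ := exists_extension (Abelianization.of.comp R.subtype) g (by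
    intro r hr
    refine h r ?_
    rwa [← Abelianization.ker_of, MonoidHom.mem_ker])
  exact ⟨k.comp Abelianization.of, fun r => DFunLike.congr_fun hk r⟩

theorem MonoidHom.exists_comp_eq_of_ker_le {A B C : Type*} [Group A] [Group B] [Group C]
    {p : A →* B} (hp : Function.Surjective p) (f : A →* C) (h : p.ker ≤ f.ker) :
    ∃ g : B →* C, ∀ a, g (p a) = f a :=
  ⟨p.liftOfSurjective hp ⟨f, h⟩, MonoidHom.liftOfRightInverse_comp_apply _ _ _ _⟩

theorem IsFreeGroup.exists_lift {F X G : Type*} [Group F] [IsFreeGroup F] [Group X] [Group G]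
    {p : X →* G} (hp : Function.Surjective p) (f : F →* G) :
    ∃ q : F →* X, ∀ x, p (q x) = f x := by
  refine ⟨IsFreeGroup.lift fun a => Function.surjInv hp (f (IsFreeGroup.of a)), fun x => ?_⟩
  refine DFunLike.congr_fun (f := p.comp _) (IsFreeGroup.ext_hom fun a => ?_) x
  simp [Function.surjInv_eq]

/-! ### Central extensions and lifts to them -/

namespace GroupExtension

section

variable {D X G : Type*} [CommGroup D] [Group X] [Group G] (S : GroupExtension D X G)

/-- The extension is central. -/
def IsCentral : Prop := ∀ d x, Commute (S.inl d) x

variable {S}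

theorem exists_inl_eq {x : X} (hx : S.rightHom x = 1) : ∃ d, S.inl d = x := by
  have : x ∈ S.inl.range := by rw [S.range_inl_eq_ker_rightHom]; exact hx
  exact this

/-- Two homomorphisms into a central extension with the same projection differ by a homomorphism
into the kernel. -/
theorem IsCentral.exists_hom_mul (hS : S.IsCentral) {K : Type*} [Group K] {q q' : K →* X}
    (h : ∀ x, S.rightHom (q x) = S.rightHom (q' x)) :
    ∃ θ : K →* D, ∀ x, q x = S.inl (θ x) * q' x := by
  have h1 : ∀ x, ∃ d, S.inl d = q x * (q' x)⁻¹ := fun x =>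
    exists_inl_eq (by simp [h])
  choose θ hθ using h1
  have h2 : ∀ x, q x = S.inl (θ x) * q' x := fun x => by simp [hθ]
  refine ⟨MonoidHom.mk' θ fun a b => S.inl_injective ?_, h2⟩
  have := (hS (θ b) (q' a)).eq
  rw [hθ, map_mul, map_mul, map_mul, h2 a, h2 b, mul_assoc (S.inl (θ a)), ← mul_assoc (q' a), ← this]
  group

/-- The two lifts differ by a homomorphism to a commutative group, which kills commutators. This
gives both naturality of the characters and uniqueness of splittings over a perfect group. -/
theorem IsCentral.eq_of_mem_commutator (hS : S.IsCentral) {K : Type*} [Group K] {q q' : K →* X}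
    (h : ∀ x, S.rightHom (q x) = S.rightHom (q' x)) {x : K} (hx : x ∈ commutator K) :
    q x = q' x := by
  obtain ⟨θ, hθ⟩ := hS.exists_hom_mul h
  have : θ x = 1 := Abelianization.commutator_subset_ker θ hx
  rw [hθ, this, map_one, one_mul]

/-- The extension with its middle term replaced by an isomorphic group. -/
def congrMiddle (S : GroupExtension D X G) {Y : Type*} [Group Y] (e : X ≃* Y) :
    GroupExtension D Y G where
  inl := e.toMonoidHom.comp S.inl
  rightHom := S.rightHom.comp e.symm.toMonoidHom
  inl_injective := e.injective.comp S.inl_injective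
  range_inl_eq_ker_rightHom := by
    ext y
    rw [MonoidHom.mem_ker]
    change _ ↔ e.symm y ∈ S.rightHom.ker
    rw [← S.range_inl_eq_ker_rightHom]
    simp [MonoidHom.mem_range, MulEquiv.eq_symm_apply]
  rightHom_surjective := S.rightHom_surjective.comp e.symm.surjective

/-- The extension with its quotient replaced by an isomorphic group. -/
def congrRight (S : GroupExtension D X G) {K : Type*} [Group K] (e : G ≃* K) :
    GroupExtension D X K where
  inl := S.inl
  rightHom := e.toMonoidHom.comp S.rightHom
  inl_injective := S.inl_injective
  range_inl_eq_ker_rightHom := by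
    rw [S.range_inl_eq_ker_rightHom]
    ext
    simp [MonoidHom.mem_ker]
  rightHom_surjective := e.surjective.comp S.rightHom_surjective

/-- A central extension of `F / ker p` by `D`, obtained from `F` by pushing out along a homomorphism
`ψ : ker p → D` that is invariant under conjugation. -/
theorem exists_pushout {F : Type*} [Group F] {p : F →* G} (hp : Function.Surjective p)
    (ψ : p.ker →* D) (hψ : ∀ (f : F) (r r' : p.ker), (r' : F) = f * r * f⁻¹ → ψ r' = ψ r) :
    ∃ (N : Subgroup (F × D)) (_ : N.Normal) (S : GroupExtension D ((F × D) ⧸ N) G)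
      (q : F →* (F × D) ⧸ N), S.IsCentral ∧ (∀ x, S.rightHom (q x) = p x) ∧
        ∀ r : p.ker, q r = S.inl (ψ r) := by
  -- The graph of `ψ⁻¹`: dividing by it identifies each relation `r` with `ψ r`. Invariance of `ψ`
  -- under conjugation makes it normal.
  let N : Subgroup (F × D) := (p.ker.subtype.prod ψ⁻¹).range
  have memN : ∀ x : F × D, x ∈ N ↔ ∃ h : x.1 ∈ p.ker, (ψ ⟨x.1, h⟩)⁻¹ = x.2 := by
    rintro ⟨f, d⟩
    constructor
    · rintro ⟨r, hr⟩
      obtain ⟨rfl, rfl⟩ := Prod.ext_iff.1 hr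
      exact ⟨r.2, rfl⟩
    · rintro ⟨h, hd⟩
      exact ⟨⟨f, h⟩, Prod.ext rfl hd⟩
  have hN : N.Normal := ⟨by
    rintro x hx y
    obtain ⟨h, hd⟩ := (memN x).1 hx
    have h' : (y * x * y⁻¹).1 ∈ p.ker := p.normal_ker.conj_mem _ h _
    refine (memN _).2 ⟨h', ?_⟩
    rw [hψ y.1 ⟨x.1, h⟩ ⟨_, h'⟩ rfl, hd]
    simp [mul_comm]⟩
  let rh : (F × D) ⧸ N →* G := QuotientGroup.lift N (p.comp (MonoidHom.fst F D)) (by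
    intro x hx
    exact ((memN x).1 hx).1)
  have key : ∀ r : p.ker, (QuotientGroup.mk' N) ((r : F), 1) = QuotientGroup.mk' N (1, ψ r) := by
    intro r
    rw [QuotientGroup.mk'_eq_mk']
    refine ⟨((r : F)⁻¹, ψ r), (memN _).2 ⟨p.ker.inv_mem r.2, ?_⟩, by simp⟩
    change (ψ r⁻¹)⁻¹ = ψ r
    simp
  let S : GroupExtension D ((F × D) ⧸ N) G :=
    { inl := (QuotientGroup.mk' N).comp (MonoidHom.inr F D)
      rightHom := rh
      inl_injective := by
        rw [injective_iff_map_eq_one]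
        intro d hd
        have : ((1, d) : F × D) ∈ N := (QuotientGroup.eq_one_iff _).1 hd
        obtain ⟨h, h'⟩ := (memN _).1 this
        have h1 : (⟨1, h⟩ : p.ker) = 1 := rfl
        simpa [h1] using h'.symm
      range_inl_eq_ker_rightHom := by
        ext x
        constructor
        · rintro ⟨d, rfl⟩
          exact map_one p
        · obtain ⟨⟨f, d⟩, rfl⟩ := QuotientGroup.mk'_surjective N x
          intro hf
          have hf : f ∈ p.ker := hf
          refine ⟨ψ ⟨f, hf⟩ * d, ?_⟩
          have h1 : ((f, d) : F × D) = (f, 1) * (1, d) := by simp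
          rw [h1, map_mul, map_mul]
          exact congrArg (· * _) (key ⟨f, hf⟩).symm
      rightHom_surjective := fun g => by
        obtain ⟨f, rfl⟩ := hp g
        exact ⟨QuotientGroup.mk' N (f, 1), rfl⟩ }
  refine ⟨N, hN, S, (QuotientGroup.mk' N).comp (MonoidHom.inl F D), ?_, fun x => rfl, key⟩
  intro d x
  obtain ⟨⟨f, d'⟩, rfl⟩ := QuotientGroup.mk'_surjective N x
  exact Commute.map (f := QuotientGroup.mk' N)
    (show Commute ((1, d) : F × D) (f, d') from Prod.ext (by simp) (mul_comm _ _))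

end

/-- A homomorphism to `G` lifts to a central extension by `ℚ/ℤ` as soon as some lift to a free group
is trivial on those relations that lie in the commutator subgroup. -/
theorem IsCentral.exists_lift {X G F K : Type*} [Group X] [Group G] [Group F] [Group K]
    {S : GroupExtension RatCircle X G} (hS : S.IsCentral) {p : F →* K}
    (hp : Function.Surjective p) (j : K →* G) (q : F →* X)
    (hq : ∀ x, S.rightHom (q x) = j (p x))
    (h : ∀ r ∈ p.ker, r ∈ commutator F → q r = 1) :
    ∃ s : K →* X, ∀ k, S.rightHom (s k) = j k := by
  obtain ⟨ψ, hψ⟩ := hS.exists_hom_mul (q := q.comp p.ker.subtype) (q' := 1) (fun r => by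
    have := r.2
    rw [MonoidHom.mem_ker] at this
    simp [hq, this])
  replace hψ : ∀ r : p.ker, q r = S.inl (ψ r) := fun r => by simpa using hψ r
  -- On `ker p` the lift `q` is the character `ψ`, trivial on commutators of `F`. Dividing `q` by an
  -- extension `θ` of `ψ` to `F` gives a lift that descends to `K`.
  obtain ⟨θ, hθ⟩ := RatCircle.exists_extension_of_commutator p.ker ψ (fun r hr => by
    rw [← map_eq_one_iff _ S.inl_injective, ← hψ, h r r.2 hr])
  let q' : F →* X := MonoidHom.mk' (fun x => S.inl (θ x)⁻¹ * q x) fun a b => by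
    have := (hS (θ b)⁻¹ (q a)).eq
    rw [map_mul, map_mul, mul_inv, map_mul, mul_assoc (S.inl (θ a)⁻¹) (q a), ← mul_assoc (q a),
      ← this]
    group
  obtain ⟨s, hs⟩ := MonoidHom.exists_comp_eq_of_ker_le hp q' (fun r hr => by
    change S.inl (θ r)⁻¹ * q r = 1
    rw [hψ ⟨r, hr⟩, ← hθ ⟨r, hr⟩, ← map_mul, inv_mul_cancel, map_one])
  refine ⟨s, fun k => ?_⟩
  obtain ⟨x, rfl⟩ := hp k
  rw [hs, ← hq]
  change S.rightHom (S.inl (θ x)⁻¹ * q x) = _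
  simp

end GroupExtension

/-! ### Amalgamating central extensions -/

/-- A central extension of `K` by `D` with a lift of a homomorphism `j : H →* K`. -/
structure CentralExtensionWithLift.{w, u, v, t} (D : Type t) {H : Type u} {K : Type v} [CommGroup D]
    [Group H] [Group K] (j : H →* K) where
  /-- the middle term -/
  E : Type w
  [group : Group E]
  /-- the extension -/
  ext : GroupExtension D E K
  central : ext.IsCentral
  /-- the lift -/
  lift : H →* E
  rightHom_lift : ∀ h, ext.rightHom (lift h) = j h

attribute [instance] CentralExtensionWithLift.group

namespace CentralExtensionWithLift

variable {D H ι : Type*} {K : ι → Type*} [CommGroup D] [Group H] [∀ i, Group (K i)]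
  {j : ∀ i, H →* K i}

/-- The embedding of `D × H`. -/
def prodHom {K : Type*} [Group K] {j : H →* K} (B : CentralExtensionWithLift D j) :
    D × H →* B.E :=
  MonoidHom.noncommCoprod B.ext.inl B.lift fun d _ => B.central d _

theorem prodHom_injective {K : Type*} [Group K] {j : H →* K} (B : CentralExtensionWithLift D j)
    (hj : Function.Injective j) : Function.Injective B.prodHom := by
  rw [injective_iff_map_eq_one]
  rintro ⟨d, h⟩ hx
  replace hx : B.ext.inl d * B.lift h = 1 := hx
  have h1 := congrArg B.ext.rightHom hx
  rw [map_mul, B.ext.rightHom_inl, B.rightHom_lift, one_mul, map_one] at h1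
  obtain rfl := (map_eq_one_iff j hj).1 h1
  rw [map_one, mul_one, map_eq_one_iff _ B.ext.inl_injective] at hx
  rw [hx]; rfl

/-- Central extensions of the factors that contain lifts of the amalgamated subgroup have an
amalgamated product, which is a central extension of the amalgamated product. -/
theorem exists_amalgam (hj : ∀ i, Function.Injective (j i))
    (B : ∀ i, CentralExtensionWithLift D (j i)) :
    ∃ (S : GroupExtension D (PushoutI fun i => (B i).prodHom) (PushoutI j)), S.IsCentral ∧
      (∀ i x, S.rightHom (PushoutI.of i x) = PushoutI.of i ((B i).ext.rightHom x)) ∧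
      ∀ i d, (PushoutI.of i ((B i).ext.inl d) : PushoutI fun i => (B i).prodHom) = S.inl d := by
  let φ := fun i => (B i).prodHom
  let inl : D →* PushoutI φ := (PushoutI.base φ).comp (MonoidHom.inl D H)
  have of_inl : ∀ i d, (PushoutI.of i ((B i).ext.inl d) : PushoutI φ) = inl d := fun i d => by
    change _ = PushoutI.base φ (d, 1)
    rw [← PushoutI.of_apply_eq_base φ i]
    rw [show φ i (d, 1) = (B i).ext.inl d * (B i).lift 1 from rfl, map_one, mul_one]
  have of_lift : ∀ i h, (PushoutI.of i ((B i).lift h) : PushoutI φ) = PushoutI.base φ (1, h) :=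
    fun i h => by
      rw [← PushoutI.of_apply_eq_base φ i]
      rw [show φ i (1, h) = (B i).ext.inl 1 * (B i).lift h from rfl, map_one, one_mul]
  have central : ∀ d x, Commute (inl d) x := fun d x => by
    induction x using PushoutI.induction_on with
    | of i g => rw [← of_inl i d]; exact ((B i).central d g).map _
    | base h =>
      exact Commute.map (f := PushoutI.base φ)
        (show Commute ((d, 1) : D × H) h from Prod.ext (mul_comm _ _) (by simp))
    | mul x y hx hy => exact hx.mul_right hy
  let p : PushoutI φ →* PushoutI j :=
    PushoutI.lift (fun i => (PushoutI.of i).comp (B i).ext.rightHom)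
      ((PushoutI.base j).comp (MonoidHom.snd D H)) (fun i => by
        ext x
        change PushoutI.of i ((B i).ext.rightHom ((B i).ext.inl _ * (B i).lift _)) =
          PushoutI.base j x.2
        rw [map_mul, GroupExtension.rightHom_inl, rightHom_lift, one_mul,
          PushoutI.of_apply_eq_base])
  have p_of : ∀ i x, p (PushoutI.of i x) = PushoutI.of i ((B i).ext.rightHom x) := fun i x =>
    PushoutI.lift_of ..
  have p_base : ∀ x, p (PushoutI.base φ x) = PushoutI.base j x.2 := fun x =>
    PushoutI.lift_base ..
  have normal : inl.range.Normal := ⟨by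
    rintro _ ⟨d, rfl⟩ x
    rw [← (central d x).eq, mul_inv_cancel_right]
    exact ⟨d, rfl⟩⟩
  let π := QuotientGroup.mk' inl.range
  have hg : ∀ i, ∃ g : K i →* PushoutI φ ⧸ inl.range,
      ∀ x, g ((B i).ext.rightHom x) = (π.comp (PushoutI.of i)) x := fun i =>
    MonoidHom.exists_comp_eq_of_ker_le (B i).ext.rightHom_surjective _ (by
      rw [← (B i).ext.range_inl_eq_ker_rightHom]
      rintro _ ⟨d, rfl⟩
      refine (QuotientGroup.eq_one_iff _).2 ⟨d, ?_⟩
      rw [of_inl])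
  choose g hg using hg
  -- Exactness without normal forms: `u` satisfies `u ∘ p = π`, so `ker p` lies in `ker π`, the
  -- image of `D`.
  let u : PushoutI j →* PushoutI φ ⧸ inl.range :=
    PushoutI.lift g ((π.comp (PushoutI.base φ)).comp (MonoidHom.inr D H)) (fun i => by
      ext h
      change g i (j i h) = π (PushoutI.base φ (1, h))
      rw [← (B i).rightHom_lift, hg, ← of_lift i]
      rfl)
  have up : ∀ x, u (p x) = π x := fun x => by
    induction x using PushoutI.induction_on with
    | of i x => rw [p_of, PushoutI.lift_of, hg]; rfl
    | base x =>
      rw [p_base, PushoutI.lift_base]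
      change π (PushoutI.base φ (1, x.2)) = _
      rw [show x = (x.1, 1) * (1, x.2) by simp, map_mul, map_mul]
      have : π (PushoutI.base φ (x.1, 1)) = 1 := (QuotientGroup.eq_one_iff _).2 ⟨x.1, rfl⟩
      rw [this, one_mul]
      simp
    | mul x y hx hy => rw [map_mul, map_mul, hx, hy, map_mul]
  refine ⟨⟨inl, p, ?_, ?_, ?_⟩, central, p_of, of_inl⟩
  · exact (PushoutI.base_injective fun i => (B i).prodHom_injective (hj i)).comp
      fun a b hab => (Prod.ext_iff.1 hab).1
  · apply le_antisymm
    · rintro _ ⟨d, rfl⟩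
      change p (PushoutI.base φ (d, 1)) = 1
      rw [p_base, map_one]
    · intro x hx
      rw [← QuotientGroup.eq_one_iff]
      change π x = 1
      rw [← up, MonoidHom.mem_ker.1 hx, map_one]
  · intro y
    induction y using PushoutI.induction_on with
    | of i k =>
      obtain ⟨x, rfl⟩ := (B i).ext.rightHom_surjective k
      exact ⟨_, p_of i x⟩
    | base h => exact ⟨PushoutI.base φ (1, h), p_base _⟩
    | mul x y hx hy =>
      obtain ⟨a, rfl⟩ := hx
      obtain ⟨b, rfl⟩ := hy
      exact ⟨a * b, map_mul _ _ _⟩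

end CentralExtensionWithLift

/-! ### Schur multipliers, their characters and functoriality -/

theorem MonoidHom.map_mem_commutator {A B : Type*} [Group A] [Group B] (f : A →* B) {a : A}
    (ha : a ∈ commutator A) : f a ∈ commutator B := by
  have h : (commutator A).map f ≤ commutator B := by
    rw [commutator_def, commutator_def, Subgroup.map_commutator]
    exact Subgroup.commutator_mono le_top le_top
  exact h ⟨a, ha, rfl⟩

namespace FreePresentation

variable {F G : Type*} [Group F] [IsFreeGroup F] [Group G] (P : FreePresentation F G)

/-- The class of an element of `R ∩ F'` in the Schur multiplier. -/
def multiplierMk {x : F} (hR : x ∈ P.relations) (hF : x ∈ commutator F) : P.SchurMultiplier :=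
  QuotientGroup.mk ⟨x, hR, hF⟩

theorem exists_multiplierMk_eq (a : P.SchurMultiplier) :
    ∃ (x : F) (hR : x ∈ P.relations) (hF : x ∈ commutator F), P.multiplierMk hR hF = a := by
  obtain ⟨⟨x, hR, hF⟩, rfl⟩ := QuotientGroup.mk_surjective a
  exact ⟨x, hR, hF, rfl⟩

theorem conj_mul_inv_mem_commutator {r : F} (hr : r ∈ P.relations) (x : F) :
    r * x * r⁻¹ * x⁻¹ ∈ ⁅P.relations, (⊤ : Subgroup F)⁆ :=
  Subgroup.commutator_mem_commutator hr (Subgroup.mem_top x)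

instance : CommGroup P.SchurMultiplier :=
  { (inferInstance : Group P.SchurMultiplier) with
    mul_comm := fun a b => by
      obtain ⟨a, rfl⟩ := QuotientGroup.mk'_surjective _ a
      obtain ⟨b, rfl⟩ := QuotientGroup.mk'_surjective _ b
      rw [← commutatorElement_eq_one_iff_mul_comm, ← map_commutatorElement]
      exact (QuotientGroup.eq_one_iff _).2 (P.conj_mul_inv_mem_commutator a.2.1 b) }

/-- `R / [R, F]` is commutative. -/
instance : CommGroup (P.relations ⧸ ⁅P.relations, (⊤ : Subgroup F)⁆.subgroupOf P.relations) :=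
  { (inferInstance :
      Group (P.relations ⧸ ⁅P.relations, (⊤ : Subgroup F)⁆.subgroupOf P.relations)) with
    mul_comm := fun a b => by
      obtain ⟨a, rfl⟩ := QuotientGroup.mk'_surjective _ a
      obtain ⟨b, rfl⟩ := QuotientGroup.mk'_surjective _ b
      rw [← commutatorElement_eq_one_iff_mul_comm, ← map_commutatorElement]
      exact (QuotientGroup.eq_one_iff _).2 (P.conj_mul_inv_mem_commutator a.2 b) }

/-- A character of the Schur multiplier extends to a homomorphism from the group of relations that
is invariant under conjugation. -/
theorem exists_hom_relations (c : P.SchurMultiplier →* RatCircle) :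
    ∃ ψ : P.hom.ker →* RatCircle,
      (∀ (f : F) (r r' : P.hom.ker), (r' : F) = f * r * f⁻¹ → ψ r' = ψ r) ∧
      ∀ (r : P.hom.ker) (hr : (r : F) ∈ commutator F), ψ r = c (P.multiplierMk r.2 hr) := by
  let π := QuotientGroup.mk' (⁅P.relations, (⊤ : Subgroup F)⁆.subgroupOf P.relations)
  -- `M(G)` embeds in the commutative group `R / [R, F]`, so `c` extends to it.
  obtain ⟨k, hk⟩ := RatCircle.exists_extension
    (π.comp (Subgroup.inclusion (inf_le_left : P.relations ⊓ commutator F ≤ P.relations)))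
    (c.comp (QuotientGroup.mk' _)) (by
      intro x hx
      have h1 : (x : F) ∈ ⁅P.relations, (⊤ : Subgroup F)⁆ :=
        (QuotientGroup.eq_one_iff (Subgroup.inclusion inf_le_left x)).1 hx
      have h2 : (QuotientGroup.mk' (⁅P.relations, (⊤ : Subgroup F)⁆.subgroupOf
        (P.relations ⊓ commutator F))) x = 1 := (QuotientGroup.eq_one_iff _).2 h1
      rw [MonoidHom.mem_ker, MonoidHom.comp_apply, h2, map_one])
  refine ⟨k.comp π, fun f r r' h => ?_, fun r hr => DFunLike.congr_fun hk ⟨r, r.2, hr⟩⟩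
  refine congrArg k (QuotientGroup.eq.2 ?_)
  change ((r' : F))⁻¹ * r ∈ ⁅P.relations, (⊤ : Subgroup F)⁆
  have h3 : ((r' : F))⁻¹ * r = f * (r : F)⁻¹ * f⁻¹ * (r : F)⁻¹⁻¹ := by
    rw [h]; group
  rw [h3, Subgroup.commutator_comm]
  exact Subgroup.commutator_mem_commutator (Subgroup.mem_top f) (inv_mem r.2)

/-- Every character of the Schur multiplier comes from a central extension by `ℚ/ℤ`. -/
theorem exists_centralExtension.{w, u, v} {F : Type u} {G : Type v} [Group F] [IsFreeGroup F]
    [Group G] (P : FreePresentation F G) (c : P.SchurMultiplier →* RatCircle) :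
    ∃ (X : Type (max w u)) (_ : Group X) (S : GroupExtension RatCircle X G) (q : F →* X),
      S.IsCentral ∧ (∀ x, S.rightHom (q x) = P.hom x) ∧
        ∀ r (hR : r ∈ P.relations) (hF : r ∈ commutator F),
          q r = S.inl (c (P.multiplierMk hR hF)) := by
  obtain ⟨ψ, hψ, hc⟩ := P.exists_hom_relations c
  obtain ⟨N, hN, S, q, hS, hq, hr⟩ := GroupExtension.exists_pushout P.surjective ψ hψ
  -- The free universe `w` lets the extensions of the two factors live in one universe and form a
  -- single family.
  let e : ((F × RatCircle) ⧸ N) ≃* ULift.{w} ((F × RatCircle) ⧸ N) := MulEquiv.ulift.symm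
  refine ⟨ULift.{w} ((F × RatCircle) ⧸ N), inferInstance, S.congrMiddle e,
    e.toMonoidHom.comp q, fun d x => ?_, hq, fun r hR hF => ?_⟩
  · exact congrArg ULift.up (hS d x.down).eq
  · exact congrArg ULift.up ((hr ⟨r, hR⟩).trans (congrArg S.inl (hc ⟨r, hR⟩ hF)))

/-- A central extension by `D` and a lift of a free presentation define a homomorphism from the
Schur multiplier to `D`. -/
theorem exists_character {D X : Type*} [CommGroup D] [Group X] {S : GroupExtension D X G}
    (hS : S.IsCentral) (q : F →* X) (hq : ∀ x, S.rightHom (q x) = P.hom x) :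
    ∃ c : P.SchurMultiplier →* D, ∀ r (hR : r ∈ P.relations) (hF : r ∈ commutator F),
      q r = S.inl (c (P.multiplierMk hR hF)) := by
  obtain ⟨ψ, hψ⟩ := hS.exists_hom_mul (q := q.comp P.relations.subtype) (q' := 1) (fun r => by
    have : P.hom r = 1 := r.2
    simp [hq, this])
  replace hψ : ∀ r : P.relations, q r = S.inl (ψ r) := fun r => by simpa using hψ r
  have hker : ⁅P.relations, (⊤ : Subgroup F)⁆ ≤ q.ker := by
    rw [Subgroup.commutator_le]
    intro r hr x _
    rw [MonoidHom.mem_ker, map_commutatorElement, hψ ⟨r, hr⟩, commutatorElement_eq_one_iff_mul_comm]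
    exact hS _ _
  refine ⟨QuotientGroup.lift _ (ψ.comp (Subgroup.inclusion inf_le_left)) fun x hx => ?_,
    fun r hR hF => hψ ⟨r, hR⟩⟩
  refine S.inl_injective ?_
  rw [map_one]
  exact (hψ ⟨x, x.2.1⟩).symm.trans (hker hx)

section map

variable {F₁ G₁ : Type*} [Group F₁] [IsFreeGroup F₁] [Group G₁] (P₁ : FreePresentation F₁ G₁)
  {j : G₁ →* G}

theorem map_mem_relations {P₁ : FreePresentation F₁ G₁} {f : F₁ →* F}
    (hf : ∀ x, P.hom (f x) = j (P₁.hom x)) {r : F₁} (hr : r ∈ P₁.relations) :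
    f r ∈ P.relations := by
  change P.hom (f r) = 1
  rw [hf, show P₁.hom r = 1 from hr, map_one]

/-- The homomorphism of Schur multipliers induced by a homomorphism of free presentations. -/
def map (f : F₁ →* F) (hf : ∀ x, P.hom (f x) = j (P₁.hom x)) :
    P₁.SchurMultiplier →* P.SchurMultiplier :=
  QuotientGroup.map _ _
    ((f.comp (P₁.relations ⊓ commutator F₁).subtype).codRestrict (P.relations ⊓ commutator F)
      fun r => ⟨P.map_mem_relations hf r.2.1, f.map_mem_commutator r.2.2⟩) (by
    intro r hr
    have h : ⁅P₁.relations, (⊤ : Subgroup F₁)⁆.map f ≤ ⁅P.relations, (⊤ : Subgroup F)⁆ := by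
      rw [Subgroup.map_commutator]
      refine Subgroup.commutator_mono ?_ le_top
      rintro _ ⟨x, hx, rfl⟩
      exact P.map_mem_relations hf hx
    exact h ⟨r, hr, rfl⟩)

variable {P P₁}

theorem map_multiplierMk {f : F₁ →* F} (hf : ∀ x, P.hom (f x) = j (P₁.hom x)) {r : F₁}
    (hR : r ∈ P₁.relations) (hF : r ∈ commutator F₁) :
    P.map P₁ f hf (P₁.multiplierMk hR hF) =
      P.multiplierMk (P.map_mem_relations hf hR) (f.map_mem_commutator hF) :=
  rfl

/-- A morphism of central extensions by `D` over `j` relates the homomorphisms to `D` that the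
extensions define on the Schur multipliers. -/
theorem comp_map_eq {D X X₁ : Type*} [CommGroup D] [Group X] [Group X₁]
    {S : GroupExtension D X G} {S₁ : GroupExtension D X₁ G₁} (hS : S.IsCentral)
    {q : F →* X} (hq : ∀ x, S.rightHom (q x) = P.hom x)
    {q₁ : F₁ →* X₁} (hq₁ : ∀ x, S₁.rightHom (q₁ x) = P₁.hom x)
    {c : P.SchurMultiplier →* D}
    (hc : ∀ r (hR : r ∈ P.relations) (hF : r ∈ commutator F),
      q r = S.inl (c (P.multiplierMk hR hF)))
    {c₁ : P₁.SchurMultiplier →* D}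
    (hc₁ : ∀ r (hR : r ∈ P₁.relations) (hF : r ∈ commutator F₁),
      q₁ r = S₁.inl (c₁ (P₁.multiplierMk hR hF)))
    {f : F₁ →* F} (hf : ∀ x, P.hom (f x) = j (P₁.hom x)) (t : X₁ →* X)
    (ht : ∀ x, S.rightHom (t x) = j (S₁.rightHom x)) (ht' : ∀ d, t (S₁.inl d) = S.inl d) :
    c.comp (P.map P₁ f hf) = c₁ := by
  refine MonoidHom.ext fun a => ?_
  obtain ⟨r, hR, hF, rfl⟩ := P₁.exists_multiplierMk_eq a
  refine S.inl_injective ?_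
  rw [MonoidHom.comp_apply, map_multiplierMk, ← hc, ← ht', ← hc₁]
  exact hS.eq_of_mem_commutator (q := q.comp f) (q' := t.comp q₁)
    (fun x => by simp [hq, ht, hf, hq₁]) hF

end map

/-- If the Schur multiplier of `H` is trivial, then every character of the Schur multiplier of `G`
comes from a central extension to which a given homomorphism `H →* G` lifts. -/
theorem exists_centralExtensionWithLift.{w, u, v} {F : Type u} {G : Type v} [Group F]
    [IsFreeGroup F] [Group G] (P : FreePresentation F G) {E H : Type*} [Group E] [IsFreeGroup E]
    [Group H] (Q : FreePresentation E H) [Subsingleton Q.SchurMultiplier] (j : H →* G)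
    (c : P.SchurMultiplier →* RatCircle) :
    ∃ (B : CentralExtensionWithLift.{max w u} RatCircle j) (q : F →* B.E),
      (∀ x, B.ext.rightHom (q x) = P.hom x) ∧
        ∀ r (hR : r ∈ P.relations) (hF : r ∈ commutator F),
          q r = B.ext.inl (c (P.multiplierMk hR hF)) := by
  obtain ⟨X, _, S, q, hS, hq, hc⟩ := exists_centralExtension.{w} P c
  obtain ⟨g, hg⟩ := IsFreeGroup.exists_lift P.surjective (j.comp Q.hom)
  -- The obstruction to lifting `j` is `c` pulled back to the trivial group `M(H)`.
  obtain ⟨s, hs⟩ := hS.exists_lift Q.surjective j (q.comp g) (fun x => by simp [hq, hg])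
    (fun r (hR : r ∈ Q.relations) hF => by
      have h : P.map Q g hg (Q.multiplierMk hR hF) = 1 := by
        rw [Subsingleton.elim (Q.multiplierMk hR hF) 1, map_one]
      rw [map_multiplierMk] at h
      rw [MonoidHom.comp_apply, hc _ (P.map_mem_relations hg hR) (g.map_mem_commutator hF), h,
        map_one, map_one])
  exact ⟨⟨X, S, hS, s, hs⟩, q, hq, hc⟩

end FreePresentation

/-! ### The map `M(G₁) × M(G₂) → M(G)` -/

namespace IsAmalgamatedProduct

universe u₁ u₂

variable {G : Type*} [Group G] {G₁ G₂ H : Subgroup G}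
  {F : Type*} {F₁ : Type u₁} {F₂ : Type u₂} [Group F] [IsFreeGroup F] [Group F₁] [IsFreeGroup F₁]
  [Group F₂] [IsFreeGroup F₂]
  {P : FreePresentation F G} {P₁ : FreePresentation F₁ G₁} {P₂ : FreePresentation F₂ G₂}
  {f₁ : F₁ →* F} (hf₁ : ∀ x, P.hom (f₁ x) = G₁.subtype (P₁.hom x))
  {f₂ : F₂ →* F} (hf₂ : ∀ x, P.hom (f₂ x) = G₂.subtype (P₂.hom x))

/-- Characters of the Schur multipliers of the factors extend to the Schur multiplier of the
amalgamated product, if that of the amalgamated subgroup is trivial. -/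
theorem exists_character (hG : IsAmalgamatedProduct G₁ G₂ H)
    {E : Type*} [Group E] [IsFreeGroup E] (Q : FreePresentation E H)
    [Subsingleton Q.SchurMultiplier] (c₁ : P₁.SchurMultiplier →* RatCircle)
    (c₂ : P₂.SchurMultiplier →* RatCircle) :
    ∃ c : P.SchurMultiplier →* RatCircle,
      c.comp (P.map P₁ f₁ hf₁) = c₁ ∧ c.comp (P.map P₂ f₂ hf₂) = c₂ := by
  obtain ⟨h, hbij⟩ := hG
  let e := MulEquiv.ofBijective _ hbij
  have he : ∀ i (x : ↥(![G₁, G₂] i)), e (PushoutI.of i x) = x := fun i x =>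
    PushoutI.lift_of (φ := fun i => Subgroup.inclusion (h i)) (fun i => (![G₁, G₂] i).subtype)
      H.subtype (fun _ => rfl) x
  let j := fun i => Subgroup.inclusion (h i)
  have hH₁ : H ≤ G₁ := h 0
  have hH₂ : H ≤ G₂ := h 1
  obtain ⟨B₁, q₁, hq₁, hc₁⟩ := FreePresentation.exists_centralExtensionWithLift.{u₂} P₁ Q
    (Subgroup.inclusion hH₁) c₁
  obtain ⟨B₂, q₂, hq₂, hc₂⟩ := FreePresentation.exists_centralExtensionWithLift.{u₁} P₂ Q
    (Subgroup.inclusion hH₂) c₂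
  let B : ∀ i, CentralExtensionWithLift RatCircle (j i) := fun
    | 0 => B₁
    | 1 => B₂
  obtain ⟨S, hS, h1, h2⟩ := CentralExtensionWithLift.exists_amalgam
    (fun i => Subgroup.inclusion_injective (h i)) B
  obtain ⟨q, hq⟩ := IsFreeGroup.exists_lift (S.congrRight e).rightHom_surjective P.hom
  obtain ⟨c, hc⟩ := P.exists_character (S := S.congrRight e) hS q hq
  have ht : ∀ i x, (S.congrRight e).rightHom (PushoutI.of i x) =
      (![G₁, G₂] i).subtype ((B i).ext.rightHom x) := fun i x => by
    change e (S.rightHom (PushoutI.of i x)) = _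
    rw [h1]
    exact he i _
  refine ⟨c, ?_, ?_⟩
  · exact FreePresentation.comp_map_eq (S := S.congrRight e) hS hq hq₁ hc hc₁ hf₁
      (PushoutI.of (G := fun i => (B i).E) 0) (ht 0) (h2 0)
  · exact FreePresentation.comp_map_eq (S := S.congrRight e) hS hq hq₂ hc hc₂ hf₂
      (PushoutI.of (G := fun i => (B i).E) 1) (ht 1) (h2 1)

/-- If the amalgamated subgroup is perfect, a character of the Schur multiplier of the amalgamated
product is determined by its restrictions to the Schur multipliers of the factors. -/
theorem character_eq_one (hG : IsAmalgamatedProduct G₁ G₂ H)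
    [Group.IsPerfect H] (c : P.SchurMultiplier →* RatCircle)
    (h₁ : c.comp (P.map P₁ f₁ hf₁) = 1) (h₂ : c.comp (P.map P₂ f₂ hf₂) = 1) : c = 1 := by
  obtain ⟨h, hbij⟩ := hG
  let e := MulEquiv.ofBijective _ hbij
  have he : ∀ i (x : ↥(![G₁, G₂] i)), e (PushoutI.of i x) = x := fun i x =>
    PushoutI.lift_of (φ := fun i => Subgroup.inclusion (h i)) (fun i => (![G₁, G₂] i).subtype)
      H.subtype (fun _ => rfl) x
  obtain ⟨X, _, S, q, hS, hq, hc⟩ := FreePresentation.exists_centralExtension.{0} P c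
  obtain ⟨s₁, hs₁⟩ := hS.exists_lift P₁.surjective G₁.subtype (q.comp f₁)
    (fun x => by rw [← hf₁, ← hq]; rfl) (fun r hR hF => by
      rw [MonoidHom.comp_apply, hc _ (P.map_mem_relations hf₁ hR) (f₁.map_mem_commutator hF)]
      exact (congrArg S.inl (DFunLike.congr_fun h₁ (P₁.multiplierMk hR hF))).trans (map_one _))
  obtain ⟨s₂, hs₂⟩ := hS.exists_lift P₂.surjective G₂.subtype (q.comp f₂)
    (fun x => by rw [← hf₂, ← hq]; rfl) (fun r hR hF => by
      rw [MonoidHom.comp_apply, hc _ (P.map_mem_relations hf₂ hR) (f₂.map_mem_commutator hF)]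
      exact (congrArg S.inl (DFunLike.congr_fun h₂ (P₂.multiplierMk hR hF))).trans (map_one _))
  let s : ∀ i : Fin 2, ↥(![G₁, G₂] i) →* X := fun
    | 0 => s₁
    | 1 => s₂
  have hs : ∀ (i : Fin 2) x, S.rightHom (s i x) = x := fun
    | 0 => hs₁
    | 1 => hs₂
  -- The splittings agree on `H`, every element of which lies in its commutator subgroup.
  let σ : PushoutI (fun i => Subgroup.inclusion (h i)) →* X :=
    PushoutI.lift s ((s 0).comp (Subgroup.inclusion (h 0))) fun i => by
      ext x
      exact hS.eq_of_mem_commutator (q := (s i).comp (Subgroup.inclusion (h i)))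
        (q' := (s 0).comp (Subgroup.inclusion (h 0)))
        (fun x => (hs i _).trans (hs 0 (Subgroup.inclusion (h 0) x)).symm)
        Group.IsPerfect.mem_commutator
  have hσ : ∀ x, S.rightHom (σ x) = e x := DFunLike.congr_fun
    (f := S.rightHom.comp σ) (g := e.toMonoidHom) (PushoutI.hom_ext_nonempty fun i => by
      refine MonoidHom.ext fun x => ?_
      refine (congrArg S.rightHom (PushoutI.lift_of ..)).trans ((hs i x).trans ?_)
      exact (he i x).symm)
  refine MonoidHom.ext fun a => ?_
  obtain ⟨r, hR, hF, rfl⟩ := P.exists_multiplierMk_eq a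
  refine S.inl_injective ?_
  -- Both `q` and the splitting composed with `P.hom` lift `P.hom`, so they agree on `F'`; the
  -- second kills relations.
  rw [← hc, hS.eq_of_mem_commutator (q := q) (q' := (σ.comp e.symm.toMonoidHom).comp P.hom)
    (fun x => by rw [hq]; exact ((hσ _).trans (e.apply_symm_apply _)).symm) hF,
    MonoidHom.comp_apply, show P.hom r = 1 from hR]
  simp

/-- Every character of the product factors through the map, so it kills the kernel; characters
separate points. -/
theorem coprod_map_injective (hG : IsAmalgamatedProduct G₁ G₂ H)
    {E : Type*} [Group E] [IsFreeGroup E] (Q : FreePresentation E H)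
    [Subsingleton Q.SchurMultiplier] :
    Function.Injective ((P.map P₁ f₁ hf₁).coprod (P.map P₂ f₂ hf₂)) := by
  rw [injective_iff_map_eq_one]
  intro a ha
  refine RatCircle.eq_one_of_forall fun k => ?_
  obtain ⟨c, h1, h2⟩ := hG.exists_character hf₁ hf₂ Q (k.comp (MonoidHom.inl _ _))
    (k.comp (MonoidHom.inr _ _))
  rw [← MonoidHom.coprod_unique k, ← h1, ← h2, ← MonoidHom.comp_coprod, MonoidHom.comp_apply, ha,
    map_one]

/-- A character of the cokernel restricts trivially to both factors, hence is trivial; so the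
cokernel is trivial. -/
theorem coprod_map_surjective (hG : IsAmalgamatedProduct G₁ G₂ H)
    [Group.IsPerfect H] :
    Function.Surjective ((P.map P₁ f₁ hf₁).coprod (P.map P₂ f₂ hf₂)) := by
  set φ := (P.map P₁ f₁ hf₁).coprod (P.map P₂ f₂ hf₂)
  intro a
  have ha : (QuotientGroup.mk' φ.range) a = 1 := RatCircle.eq_one_of_forall fun k => by
    have hφ : ∀ b, k (QuotientGroup.mk' φ.range (φ b)) = 1 := fun b => by
      rw [show QuotientGroup.mk' φ.range (φ b) = 1 from (QuotientGroup.eq_one_iff _).2 ⟨b, rfl⟩,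
        map_one]
    have := hG.character_eq_one hf₁ hf₂ (k.comp (QuotientGroup.mk' φ.range))
      (MonoidHom.ext fun b => by simpa [φ] using hφ (b, 1))
      (MonoidHom.ext fun b => by simpa [φ] using hφ (1, b))
    exact DFunLike.congr_fun this a
  exact (QuotientGroup.eq_one_iff _).1 ha

end IsAmalgamatedProduct

theorem mainTheorem4 {G : Type*} [Group G] (G₁ G₂ H : Subgroup G)
    (hG : IsAmalgamatedProduct G₁ G₂ H)
    {F F₁ F₂ E : Type*} [Group F] [IsFreeGroup F] [Group F₁] [IsFreeGroup F₁]
    [Group F₂] [IsFreeGroup F₂] [Group E] [IsFreeGroup E]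
    (P : FreePresentation F G) (P₁ : FreePresentation F₁ G₁) (P₂ : FreePresentation F₂ G₂)
    (Q : FreePresentation E H) :
    (Subsingleton Q.SchurMultiplier →
      ∃ K : Subgroup P.SchurMultiplier,
        Nonempty (K ≃* P₁.SchurMultiplier × P₂.SchurMultiplier)) ∧
    (Group.IsPerfect H → Subsingleton Q.SchurMultiplier →
      Nonempty (P.SchurMultiplier ≃* P₁.SchurMultiplier × P₂.SchurMultiplier)) := by
  obtain ⟨f₁, hf₁⟩ := IsFreeGroup.exists_lift P.surjective (G₁.subtype.comp P₁.hom)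
  obtain ⟨f₂, hf₂⟩ := IsFreeGroup.exists_lift P.surjective (G₂.subtype.comp P₂.hom)
  constructor
  · intro _
    exact ⟨_, ⟨(MonoidHom.ofInjective (hG.coprod_map_injective hf₁ hf₂ Q)).symm⟩⟩
  · intro _ _
    exact ⟨(MulEquiv.ofBijective _ ⟨hG.coprod_map_injective hf₁ hf₂ Q,
      hG.coprod_map_surjective hf₁ hf₂⟩).symm⟩
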